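/- Let $A$ be a finite-dimensional algebra over a field, let $\operatorname{mod}A$ be the category of finitely generated right $A$-modules, and let $d\ge 1$ be an integer. All subcategories are full and closed under isomorphisms, finite direct sums and direct summands. Let $\mathcal M\subseteq\operatorname{mod}A$ be a $d$-cluster tilting subcategory, i.e. a functorially finite subcategory with $$\mathcal M=\{X\in\operatorname{mod}A\mid \operatorname{Ext}^i_A(X,M)=0\ \ \forall M\in\mathcal M,\ 1\le i\le d-1\}=\{Y\in\operatorname{mod}A\mid \operatorname{Ext}^i_A(M,Y)=0\ \ \forall M\in\mathcal M,\ 1\le i\le d-1\}.$$ A subcategory $\mathcal U\subseteq\mathcal M$ is a $d$-torsion class in $\mathcal M$ if for every $M\in\mathcal M$ there is an exact sequence $0\to U_M\to M\to V_1\to\cdots\to V_d\to 0$ with all terms in $\mathcal M$ and with $U_M\in\mathcal U$, such that $0\to\operatorname{Hom}_A(U,V_1)\to\cdots\to\operatorname{Hom}_A(U,V_d)\to 0$ is exact for every $U\in\mathcal U$; then $U_M\to M$ is called the $d$-torsion subobject of $M$ with respect to $\mathcal U$. Let $\mathcal T$ be a torsion class in $\operatorname{mod}A$, with associated torsion pair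 $(\mathcal T,\mathcal F)$ and canonical short exact sequences $0\to tX\to X\to fX\to 0$ ($tX\in\mathcal T$, $fX\in\mathcal F$) for $X \in \operatorname{mod} A$. We say that $\mathcal T$ induces a $d$-torsion class in $\mathcal M$ if $\mathcal T\cap\mathcal M$ is a $d$-torsion class in $\mathcal M$ and, for every $M\in\mathcal M$, the torsion subobject $tM$ coincides with the $d$-torsion subobject $U_M$ of $M$ with respect to $\mathcal T\cap\mathcal M$. Then $\mathcal T$ induces a $d$-torsion class in $\mathcal M$ if and only if both of the following hold: 1. $\operatorname{Ext}^{d-1}_A(tM,fM')=0$ for all $M,M'\in\mathcal M$; 2. $tM\in\mathcal M$ for all $M\in\mathcal M$. (For $d=1$, $\operatorname{Ext}^0_A$ means $\operatorname{Hom}_A$.) -/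

import Mathlib

open CategoryTheory Limits

universe u w

namespace HigherTorsion

section Subcategories

variable {R : Type u} [Ring R]

/-- Standing convention: a *subcategory of `mod R`* is a full subcategory of the category of
finitely generated `R`-modules which is closed under isomorphisms, finite direct sums
(in particular it contains the zero modules) and direct summands. -/
structure IsSubcategory (P : ObjectProperty (ModuleCat.{u} R)) : Prop where
  finite : ∀ X, P X → Module.Finite R X
  iso : ∀ {X Y : ModuleCat.{u} R}, (X ≅ Y) → P X → P Y
  zero : ∀ X, IsZero X → P X
  sum : ∀ X Y, P X → P Y → P (X ⊞ Y)
  summand : ∀ X Y, P (X ⊞ Y) → P X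

/-- `f : Y ⟶ X` is a left `P`-approximation of `Y`. -/
def IsLeftApproximation (P : ObjectProperty (ModuleCat.{u} R)) {Y X : ModuleCat.{u} R}
    (f : Y ⟶ X) : Prop :=
  P X ∧ ∀ (X' : ModuleCat.{u} R) (g : Y ⟶ X'), P X' → ∃ h : X ⟶ X', f ≫ h = g

/-- `f : X ⟶ Y` is a right `P`-approximation of `Y`. -/
def IsRightApproximation (P : ObjectProperty (ModuleCat.{u} R)) {X Y : ModuleCat.{u} R}
    (f : X ⟶ Y) : Prop :=
  P X ∧ ∀ (X' : ModuleCat.{u} R) (g : X' ⟶ Y), P X' → ∃ h : X' ⟶ X, h ≫ f = g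

/-- `P` is functorially finite in `mod R`: every finitely generated module has a left and a
right `P`-approximation. -/
structure IsFunctoriallyFinite (P : ObjectProperty (ModuleCat.{u} R)) : Prop where
  covariantly : ∀ Y : ModuleCat.{u} R, Module.Finite R Y →
    ∃ (X : ModuleCat.{u} R) (f : Y ⟶ X), IsLeftApproximation P f
  contravariantly : ∀ Y : ModuleCat.{u} R, Module.Finite R Y →
    ∃ (X : ModuleCat.{u} R) (f : X ⟶ Y), IsRightApproximation P f

/-- `M` is a `d`-cluster tilting subcategory of `mod R`. -/
structure IsClusterTilting (d : ℕ) (M : ObjectProperty (ModuleCat.{u} R)) : Prop where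
  subcategory : IsSubcategory M
  functoriallyFinite : IsFunctoriallyFinite M
  mem_iff_left : ∀ X : ModuleCat.{u} R, M X ↔ Module.Finite R X ∧
    ∀ N, M N → ∀ i : ℕ, 1 ≤ i → i ≤ d - 1 → Subsingleton (Abelian.Ext.{u} X N i)
  mem_iff_right : ∀ Y : ModuleCat.{u} R, M Y ↔ Module.Finite R Y ∧
    ∀ N, M N → ∀ i : ℕ, 1 ≤ i → i ≤ d - 1 → Subsingleton (Abelian.Ext.{u} N Y i)

/-- `0 ⟶ tX ⟶ X ⟶ fX ⟶ 0` (with maps `i` and `p`) is a short exact sequence with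
`tX` in `T` and `fX` in `F`. -/
def IsTorsionSequence (T F : ObjectProperty (ModuleCat.{u} R)) {tX X fX : ModuleCat.{u} R}
    (i : tX ⟶ X) (p : X ⟶ fX) : Prop :=
  T tX ∧ F fX ∧ ∃ h : i ≫ p = 0, (ShortComplex.mk i p h).ShortExact

/-- `(T, F)` is a torsion pair in `mod R`. -/
structure IsTorsionPair (T F : ObjectProperty (ModuleCat.{u} R)) : Prop where
  subcategory_left : IsSubcategory T
  subcategory_right : IsSubcategory F
  hom_eq_zero : ∀ (X Y : ModuleCat.{u} R) (g : X ⟶ Y), T X → F Y → g = 0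
  exists_sequence : ∀ X : ModuleCat.{u} R, Module.Finite R X →
    ∃ (tX fX : ModuleCat.{u} R) (i : tX ⟶ X) (p : X ⟶ fX), IsTorsionSequence T F i p

/-- `T` is a torsion class in `mod R`. -/
def IsTorsionClass (T : ObjectProperty (ModuleCat.{u} R)) : Prop :=
  ∃ F, IsTorsionPair T F

/-- `0 ⟶ tX ⟶ X ⟶ fX ⟶ 0` is the canonical short exact sequence of `X` with respect to the
torsion pair with torsion class `T` (the torsion free class is determined by `T`). -/
def IsCanonicalSequence (T : ObjectProperty (ModuleCat.{u} R)) {tX X fX : ModuleCat.{u} R}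
    (i : tX ⟶ X) (p : X ⟶ fX) : Prop :=
  ∃ F, IsTorsionPair T F ∧ IsTorsionSequence T F i p

/-- The class `tM = {tX | X ∈ M}` of torsion subobjects of objects of `M`. -/
def torsionPart (T M : ObjectProperty (ModuleCat.{u} R)) : ObjectProperty (ModuleCat.{u} R) :=
  fun Y => ∃ (X Z : ModuleCat.{u} R) (i : Y ⟶ X) (p : X ⟶ Z), M X ∧ IsCanonicalSequence T i p

/-- The class `fM = {fX | X ∈ M}` of torsion free quotients of objects of `M`. -/
def torsionFreePart (T M : ObjectProperty (ModuleCat.{u} R)) :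
    ObjectProperty (ModuleCat.{u} R) :=
  fun Z => ∃ (Y X : ModuleCat.{u} R) (i : Y ⟶ X) (p : X ⟶ Z), M X ∧ IsCanonicalSequence T i p

/-- `K` is a `d`-exact sequence `0 ⟶ K⁰ ⟶ K¹ ⟶ ⋯ ⟶ Kᵈ⁺¹ ⟶ 0` in `M`: all its terms are in `M`,
it is concentrated in degrees `0, …, d + 1`, and it is exact everywhere (exactness in degree `0`
says that `K⁰ ⟶ K¹` is a monomorphism). -/
structure IsDExact (d : ℕ) (M : ObjectProperty (ModuleCat.{u} R))
    (K : CochainComplex (ModuleCat.{u} R) ℕ) : Prop where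
  mem : ∀ i, M (K.X i)
  isZero : ∀ i, d + 1 < i → IsZero (K.X i)
  exact : ∀ i, K.ExactAt i

/-- `K` is a `d`-exact sequence `0 ⟶ U_X ⟶ X ⟶ V₁ ⟶ ⋯ ⟶ V_d ⟶ 0` in `M`, where `U_X = K⁰`,
`X = K¹` and `V_j = Kʲ⁺¹`, such that `U_X` is in `U` and
`0 ⟶ Hom(N, V₁) ⟶ ⋯ ⟶ Hom(N, V_d) ⟶ 0` is exact for all `N` in `U`.
Exactness is spelled out at `Hom(N, V₁)` and at `Hom(N, V_j)` for `2 ≤ j ≤ d`;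
the target of the last differential `K.d (d + 1) (d + 2)` is zero. -/
structure IsDTorsionSequence (d : ℕ) (M U : ObjectProperty (ModuleCat.{u} R))
    (K : CochainComplex (ModuleCat.{u} R) ℕ) : Prop where
  dExact : IsDExact d M K
  mem : U (K.X 0)
  hom_exact_first : ∀ N, U N → ∀ g : N ⟶ K.X 2, g ≫ K.d 2 3 = 0 → g = 0
  hom_exact : ∀ N, U N → ∀ j, 2 ≤ j → j ≤ d → ∀ g : N ⟶ K.X (j + 1),
    g ≫ K.d (j + 1) (j + 2) = 0 → ∃ h : N ⟶ K.X j, h ≫ K.d j (j + 1) = g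

/-- `U` is a `d`-torsion class in `M`: a subcategory of `M` such that every `X` in `M` is the
second term of a sequence as in `IsDTorsionSequence`, whose first term is then the `d`-torsion
subobject of `X`. -/
structure IsDTorsionClass (d : ℕ) (M U : ObjectProperty (ModuleCat.{u} R)) : Prop where
  subcategory : IsSubcategory U
  le : U ≤ M
  exists_sequence : ∀ X, M X → ∃ K : CochainComplex (ModuleCat.{u} R) ℕ,
    IsDTorsionSequence d M U K ∧ Nonempty (K.X 1 ≅ X)

/-- The torsion class `T` induces a `d`-torsion class in `M`: the intersection `T ∩ M` is a
`d`-torsion class in `M`, and the torsion subobject and the `d`-torsion subobject of every object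
of `M` coincide (as subobjects). -/
structure InducesDTorsionClass (d : ℕ) (M T : ObjectProperty (ModuleCat.{u} R)) : Prop where
  isDTorsionClass : IsDTorsionClass d M (T ⊓ M)
  subobject_eq : ∀ K : CochainComplex (ModuleCat.{u} R) ℕ, IsDTorsionSequence d M (T ⊓ M) K →
    ∀ (Y Z : ModuleCat.{u} R) (i : Y ⟶ K.X 1) (p : K.X 1 ⟶ Z), IsCanonicalSequence T i p →
      ∃ e : Y ≅ K.X 0, e.hom ≫ K.d 0 1 = i

end Subcategories

end HigherTorsion

/-! Everything is dimension shifting along `0 ⟶ fX ⟶ V₁ ⟶ ⋯ ⟶ V_d ⟶ 0` with all `V_j` in `M`: for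
`U` in `T ⊓ M`, the groups `Ext^i(U, V_j)` vanish for `1 ≤ i ≤ d - 1`.

If `T` induces a `d`-torsion class, `tX ≅ U_X` lies in `M` and `fX` is the kernel of `V₁ ⟶ V₂`.
Surjectivity of `Hom(U, V_{d-1}) ⟶ Hom(U, V_d)` kills `Ext¹` into the kernel of `V_{d-1} ⟶ V_d`, and
shifting turns this into `Ext^{d-1}(U, fX) = 0` (`IsDTorsionSequence.ext_Z_two`). For `d = 1` this
is just `Hom(T, F) = 0`.

Conversely, `fX` has an `M`-coresolution with `d` terms (`IsClusterTilting.exists_coresolution`),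
which is spliced with `0 ⟶ tX ⟶ X ⟶ fX ⟶ 0`. The two conditions give `Ext^i(U, fX) = 0` for `1 ≤ i ≤
d - 1`; with `Hom(U, fX) = 0` this makes the sequence exact under `Hom(U, -)`
(`IsClusterTilting.exists_isDTorsionSequence`). -/

namespace HigherTorsion

/-! ### Dimension shifting for Ext along one short exact sequence -/

section ExtShift

universe w' v' u'

variable {C : Type u'} [Category.{v'} C] [Abelian C] [HasExt.{w'} C] {S : ShortComplex C}

open Abelian

lemma ext_subsingleton_X₃ (hS : S.ShortExact) (U : C) (n : ℕ)
    (h₂ : Subsingleton (Ext.{w'} U S.X₂ n)) (h₁ : Subsingleton (Ext.{w'} U S.X₁ (n + 1))) :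
    Subsingleton (Ext.{w'} U S.X₃ n) := by
  refine subsingleton_of_forall_eq 0 fun x => ?_
  obtain ⟨y, rfl⟩ := Ext.covariant_sequence_exact₃ U hS x rfl (Subsingleton.elim _ _)
  simp [Subsingleton.elim y 0]

lemma ext_subsingleton_X₁ (hS : S.ShortExact) (U : C) (n : ℕ)
    (h₃ : Subsingleton (Ext.{w'} U S.X₃ n)) (h₂ : Subsingleton (Ext.{w'} U S.X₂ (n + 1))) :
    Subsingleton (Ext.{w'} U S.X₁ (n + 1)) := by
  refine subsingleton_of_forall_eq 0 fun x => ?_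
  obtain ⟨y, rfl⟩ := Ext.covariant_sequence_exact₁ U hS x (Subsingleton.elim _ _) rfl
  simp [Subsingleton.elim y 0]

lemma exists_lift_of_ext_one (hS : S.ShortExact) (U : C)
    (h₁ : Subsingleton (Ext.{w'} U S.X₁ 1)) (g : U ⟶ S.X₃) : ∃ h : U ⟶ S.X₂, h ≫ S.g = g := by
  obtain ⟨y, hy⟩ := Ext.covariant_sequence_exact₃ U hS (Ext.mk₀ g) (zero_add 1)
    (Subsingleton.elim _ _)
  obtain ⟨y, rfl⟩ := Ext.homEquiv₀.symm.surjective y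
  refine ⟨y, Ext.homEquiv₀.symm.injective ?_⟩
  simpa using hy

/-- Every class in `Ext¹(U, X₁)` comes from some `U ⟶ X₃` under the connecting map, which kills the
maps that lift to `X₂`. -/
lemma ext_one_subsingleton_of_lift (hS : S.ShortExact) (U : C)
    (hl : ∀ g : U ⟶ S.X₃, ∃ h : U ⟶ S.X₂, h ≫ S.g = g)
    (h₂ : Subsingleton (Ext.{w'} U S.X₂ 1)) : Subsingleton (Ext.{w'} U S.X₁ 1) := by
  refine subsingleton_of_forall_eq 0 fun x => ?_
  obtain ⟨y, rfl⟩ := Ext.covariant_sequence_exact₁ U hS x (Subsingleton.elim _ _) (zero_add 1)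
  obtain ⟨y, rfl⟩ := Ext.homEquiv₀.symm.surjective y
  obtain ⟨h, rfl⟩ := hl y
  change (Ext.mk₀ (h ≫ S.g)).comp _ _ = 0
  rw [← Ext.mk₀_comp_mk₀, Ext.comp_assoc_of_second_deg_zero, hS.comp_extClass, Ext.comp_zero]

lemma ext_one_subsingleton_of_extend (hS : S.ShortExact) (N : C)
    (hl : ∀ g : S.X₁ ⟶ N, ∃ h : S.X₂ ⟶ N, S.f ≫ h = g)
    (h₂ : Subsingleton (Ext.{w'} S.X₂ N 1)) : Subsingleton (Ext.{w'} S.X₃ N 1) := by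
  refine subsingleton_of_forall_eq 0 fun x => ?_
  obtain ⟨y, rfl⟩ := Ext.contravariant_sequence_exact₃ hS N x (Subsingleton.elim _ _) (add_zero 1)
  obtain ⟨y, rfl⟩ := Ext.homEquiv₀.symm.surjective y
  obtain ⟨h, rfl⟩ := hl y
  change hS.extClass.comp (Ext.mk₀ (S.f ≫ h)) _ = 0
  rw [← Ext.mk₀_comp_mk₀, ← Ext.comp_assoc_of_second_deg_zero, hS.extClass_comp, Ext.zero_comp]

lemma ext_subsingleton_contra_X₃ (hS : S.ShortExact) (N : C) (n : ℕ)
    (h₁ : Subsingleton (Ext.{w'} S.X₁ N n)) (h₂ : Subsingleton (Ext.{w'} S.X₂ N (n + 1))) :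
    Subsingleton (Ext.{w'} S.X₃ N (n + 1)) := by
  refine subsingleton_of_forall_eq 0 fun x => ?_
  obtain ⟨y, rfl⟩ := Ext.contravariant_sequence_exact₃ hS N x (Subsingleton.elim _ _)
    (Nat.add_comm 1 n)
  simp [Subsingleton.elim y 0]

end ExtShift

/-! ### Finitely generated injective modules over a finite-dimensional algebra -/

section InjectiveHull

lemma injective_of_field {k : Type w} [Field k] (V : ModuleCat.{u} k) : Injective V where
  factors {X Y} g f hf := by
    obtain ⟨l, hl⟩ := f.hom.exists_leftInverse_of_injective
      (LinearMap.ker_eq_bot.2 ((ModuleCat.mono_iff_injective f).1 hf))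
    refine ⟨ModuleCat.ofHom (g.hom ∘ₗ l), ?_⟩
    ext x
    have := LinearMap.congr_fun hl x
    exact congrArg g this

/-- The module embeds in `Hom_k(B, Y)` by `y ↦ (b ↦ b • y)`, with evaluation at `1` as retraction of
sets. Coextension is right adjoint to the exact restriction functor, so it preserves injectives. -/
lemma exists_mono_injective_finite (k : Type w) [Field k] {B : Type u} [Ring B] [Algebra k B]
    [Module.Finite k B] (Y : ModuleCat.{u} B) (hY : Module.Finite B Y) :
    ∃ (I : ModuleCat.{u} B) (f : Y ⟶ I), Injective I ∧ Mono f ∧ Module.Finite B I := by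
  let φ := algebraMap k B
  let adj := ModuleCat.restrictCoextendScalarsAdj.{u} φ
  let V := (ModuleCat.restrictScalars φ).obj Y
  have : Injective V := injective_of_field V
  refine ⟨(ModuleCat.coextendScalars φ).obj V, adj.unit.app Y,
    Injective.injective_of_adjoint adj V, ?_, ?_⟩
  · rw [ModuleCat.mono_iff_injective]
    intro x y h
    have h1 : (1 : B) • x = (1 : B) • y :=
      congrArg (fun g => ModuleCat.CoextendScalars.equiv φ V g (1 : B)) h
    simpa using h1
  · let I := (ModuleCat.coextendScalars φ).obj V
    let _ : Module k I := Module.compHom I φ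
    have : IsScalarTower k B I := ⟨fun a b x => by
      rw [Algebra.smul_def, mul_smul]; rfl⟩
    let _ : Module k Y := Module.compHom Y φ
    have : IsScalarTower k B Y := ⟨fun a b x => by
      rw [Algebra.smul_def, mul_smul]; rfl⟩
    have hY' : Module.Finite k Y := Module.Finite.trans B Y
    have : Module.Finite k V := hY'
    let B' := (ModuleCat.restrictScalars φ).obj (ModuleCat.of B B)
    have : Module.Finite k B' := by
      let e : B ≃ₗ[k] B' :=
        { AddEquiv.refl B with map_smul' := fun a b => Algebra.smul_def a b }
      exact Module.Finite.equiv e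
    let e : I ≃+ (B' →ₗ[k] V) := (ModuleCat.CoextendScalars.equiv φ V).toAddEquiv
    -- The action on `Hom_k(B, Y)` is by right multiplication on the argument; it agrees with the
    -- pointwise `k`-action because `k` is central in `B`.
    have he : ∀ (a : k) (x : I), e (a • x) = a • e x := fun a x => by
      refine LinearMap.ext fun s => ?_
      change (e x) ((show B from s) * φ a) = a • (e x) s
      rw [← map_smul, ← Algebra.commutes]
      rfl
    have : Module.Finite k I :=
      Module.Finite.equiv ({ e with map_smul' := he } : I ≃ₗ[k] (B' →ₗ[k] V)).symm
    exact Module.Finite.of_restrictScalars_finite k B I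

end InjectiveHull

/-! ### Splicing exact complexes from short exact sequences -/

section Splice

variable {R : Type u} [Ring R]

/-- A sequence of short exact sequences `0 ⟶ Zⁿ ⟶ Xⁿ ⟶ Zⁿ⁺¹ ⟶ 0`. -/
structure SplicedSequence (R : Type u) [Ring R] where
  Z : ℕ → ModuleCat.{u} R
  X : ℕ → ModuleCat.{u} R
  ι : ∀ n, Z n ⟶ X n
  π : ∀ n, X n ⟶ Z (n + 1)
  zero : ∀ n, ι n ≫ π n = 0
  shortExact : ∀ n, (ShortComplex.mk (ι n) (π n) (zero n)).ShortExact

namespace SplicedSequence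

lemma mono_ι (S : SplicedSequence R) (n : ℕ) : Mono (S.ι n) := (S.shortExact n).mono_f

lemma epi_π (S : SplicedSequence R) (n : ℕ) : Epi (S.π n) := (S.shortExact n).epi_g

lemma exists_factor (S : SplicedSequence R) {n : ℕ} {U : ModuleCat.{u} R} (g : U ⟶ S.X n)
    (hg : g ≫ S.π n = 0) : ∃ h : U ⟶ S.Z n, h ≫ S.ι n = g := by
  have := S.mono_ι n
  exact ⟨_, (S.shortExact n).exact.lift_f g hg⟩

/-- Prepend a short exact sequence `0 ⟶ A ⟶ B ⟶ Z⁰ ⟶ 0`. -/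
def cons (S : SplicedSequence R) {A B : ModuleCat.{u} R} (f : A ⟶ B) (g : B ⟶ S.Z 0)
    (w : f ≫ g = 0) (h : (ShortComplex.mk f g w).ShortExact) : SplicedSequence R where
  Z n := match n with | 0 => A | n + 1 => S.Z n
  X n := match n with | 0 => B | n + 1 => S.X n
  ι n := match n with | 0 => f | n + 1 => S.ι n
  π n := match n with | 0 => g | n + 1 => S.π n
  zero n := match n with | 0 => w | n + 1 => S.zero n
  shortExact n := match n with | 0 => h | n + 1 => S.shortExact n

lemma ι_comp (S : SplicedSequence R) (n : ℕ) : S.ι n ≫ S.π n ≫ S.ι (n + 1) = 0 := by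
  rw [← Category.assoc, S.zero, zero_comp]

lemma comp_comp (S : SplicedSequence R) (n : ℕ) :
    (S.π n ≫ S.ι (n + 1)) ≫ S.π (n + 1) ≫ S.ι (n + 2) = 0 := by
  rw [Category.assoc, ι_comp, comp_zero]

lemma exact_comp (S : SplicedSequence R) (n : ℕ) :
    (ShortComplex.mk _ _ (S.comp_comp n)).Exact := by
  let φ : ShortComplex.mk _ _ (S.comp_comp n) ⟶ ShortComplex.mk _ _ (S.ι_comp (n + 1)) :=
    { τ₁ := S.π n, τ₂ := 𝟙 _, τ₃ := 𝟙 _ }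
  let ψ : ShortComplex.mk _ _ (S.zero (n + 1)) ⟶ ShortComplex.mk _ _ (S.ι_comp (n + 1)) :=
    { τ₁ := 𝟙 _, τ₂ := 𝟙 _, τ₃ := S.ι (n + 2) }
  have : Epi φ.τ₁ := S.epi_π n
  have : Mono ψ.τ₃ := S.mono_ι (n + 2)
  have : IsIso φ.τ₂ := inferInstanceAs (IsIso (𝟙 _))
  have : Mono φ.τ₃ := inferInstanceAs (Mono (𝟙 _))
  have : Epi ψ.τ₁ := inferInstanceAs (Epi (𝟙 _))
  have : IsIso ψ.τ₂ := inferInstanceAs (IsIso (𝟙 _))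
  rw [ShortComplex.exact_iff_of_epi_of_isIso_of_mono φ,
    ← ShortComplex.exact_iff_of_epi_of_isIso_of_mono ψ]
  exact (S.shortExact (n + 1)).exact

/-- The complex `X⁰ ⟶ X¹ ⟶ ⋯` obtained by splicing. -/
noncomputable def complex (S : SplicedSequence R) : CochainComplex (ModuleCat.{u} R) ℕ :=
  CochainComplex.of S.X (fun n => S.π n ≫ S.ι (n + 1)) S.comp_comp

lemma complex_d (S : SplicedSequence R) (n : ℕ) :
    S.complex.d n (n + 1) = S.π n ≫ S.ι (n + 1) :=
  CochainComplex.of_d S.X (fun n => S.π n ≫ S.ι (n + 1)) n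

lemma complex_exactAt (S : SplicedSequence R) (h0 : IsZero (S.Z 0)) (n : ℕ) :
    S.complex.ExactAt n := by
  have := S.mono_ι
  have := S.epi_π
  cases n with
  | zero =>
    rw [HomologicalComplex.exactAt_iff' _ 0 0 1 (by simp) (by simp),
      ShortComplex.exact_iff_mono _ (S.complex.shape 0 0 (by simp))]
    change Mono (S.complex.d 0 1)
    rw [complex_d]
    -- The complex starts at `X⁰`, so exactness there needs `Z⁰ = 0`.
    have h : Mono (S.π 0) := (S.shortExact 0).exact.mono_g (h0.eq_of_src _ _)
    exact mono_comp' h (S.mono_ι 1)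
  | succ n =>
    rw [HomologicalComplex.exactAt_iff' _ n (n + 1) (n + 2) (by simp) (by simp)]
    exact ShortComplex.exact_of_iso (S₁ := ShortComplex.mk _ _ (S.comp_comp n)) (ShortComplex.isoMk (Iso.refl _) (Iso.refl _) (Iso.refl _)
      (((Category.id_comp _).trans (S.complex_d n)).trans (Category.comp_id _).symm)
      (((Category.id_comp _).trans (S.complex_d (n + 1))).trans (Category.comp_id _).symm))
      (S.exact_comp n)

/-- An exact complex is spliced from its cycles. -/
noncomputable def ofExact (K : CochainComplex (ModuleCat.{u} R) ℕ) (hK : ∀ i, K.ExactAt i) :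
    SplicedSequence R where
  Z n := kernel (K.d n (n + 1))
  X n := K.X n
  ι n := kernel.ι _
  π n := kernel.lift _ (K.d n (n + 1)) (K.d_comp_d _ _ _)
  zero n := by simp [← cancel_mono (kernel.ι (K.d (n + 1) (n + 1 + 1)))]
  shortExact n := by
    have hn := (K.exactAt_iff' n (n + 1) (n + 1 + 1) (by simp) (by simp)).1 (hK (n + 1))
    have : Epi (kernel.lift (K.d (n + 1) (n + 1 + 1)) (K.d n (n + 1)) (K.d_comp_d _ _ _)) :=
      hn.epi_kernelLift
    refine ShortComplex.ShortExact.mk' ?_ inferInstance this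
    refine ShortComplex.exact_of_f_is_kernel _ (KernelFork.IsLimit.ofι' _ _ fun {W} k hk => ?_)
    have h : k ≫ K.d n (n + 1) = 0 := by
      simpa using hk =≫ kernel.ι (K.d (n + 1) (n + 1 + 1))
    exact ⟨kernel.lift _ k h, kernel.lift_ι _ _ _⟩

lemma ofExact_π_ι (K : CochainComplex (ModuleCat.{u} R) ℕ) (hK : ∀ i, K.ExactAt i) (n : ℕ) :
    (ofExact K hK).π n ≫ (ofExact K hK).ι (n + 1) = K.d n (n + 1) :=
  kernel.lift_ι _ _ _

lemma ext_Z_of_ext_zero (S : SplicedSequence R) (U : ModuleCat.{u} R) (m : ℕ)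
    (hX : ∀ j i, 1 ≤ i → i ≤ m → Subsingleton (Abelian.Ext.{u} U (S.X j) i))
    (hZ : ∀ i, 1 ≤ i → i ≤ m → Subsingleton (Abelian.Ext.{u} U (S.Z 0) i)) (j : ℕ) :
    ∀ i, 1 ≤ i → i + j ≤ m → Subsingleton (Abelian.Ext.{u} U (S.Z j) i) := by
  induction j with
  | zero => exact hZ
  | succ j ih =>
    exact fun i h1 h2 => ext_subsingleton_X₃ (S.shortExact j) U i (hX j i h1 (by omega))
      (ih (i + 1) (by omega) (by omega))

/-- Shifts in the opposite direction to `ext_Z_of_ext_zero`: from `Ext¹` of a late cosyzygy to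
higher Ext of an early one. -/
lemma ext_Z_of_ext_one (S : SplicedSequence R) (U : ModuleCat.{u} R) (m : ℕ)
    (hX : ∀ j i, 1 ≤ i → i ≤ m → Subsingleton (Abelian.Ext.{u} U (S.X j) i)) (i : ℕ) :
    ∀ j, i + 1 ≤ m → Subsingleton (Abelian.Ext.{u} U (S.Z (j + i)) 1) →
      Subsingleton (Abelian.Ext.{u} U (S.Z j) (i + 1)) := by
  induction i with
  | zero => exact fun j _ h => h
  | succ i ih =>
    intro j hi h
    refine ext_subsingleton_X₁ (S.shortExact j) U (i + 1) (ih (j + 1) (by omega) ?_)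
      (hX j _ (by omega) hi)
    rwa [show j + 1 + i = j + (i + 1) by omega]

end SplicedSequence

end Splice

/-! ### Coresolutions by a cluster tilting subcategory -/

section Coresolution

variable {R : Type u} [Ring R] {d : ℕ} {M : ObjectProperty (ModuleCat.{u} R)}

lemma IsClusterTilting.finite (hM : IsClusterTilting d M) {X : ModuleCat.{u} R} (h : M X) :
    Module.Finite R X :=
  hM.subcategory.finite X h

lemma IsClusterTilting.ext_subsingleton (hM : IsClusterTilting d M) {X Y : ModuleCat.{u} R}
    (hX : M X) (hY : M Y) (i : ℕ) (h1 : 1 ≤ i) (h2 : i ≤ d - 1) :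
    Subsingleton (Abelian.Ext.{u} X Y i) :=
  ((hM.mem_iff_left X).1 hX).2 Y hY i h1 h2

lemma finite_of_epi {X Y : ModuleCat.{u} R} (f : X ⟶ Y) [Epi f] (hX : Module.Finite R X) :
    Module.Finite R Y :=
  Module.Finite.of_surjective f.hom ((ModuleCat.epi_iff_surjective f).1 inferInstance)

/-- Finitely generated injectives lie in `M`, so an embedding into one factors through any left
approximation, which is therefore mono. Objects of `M` get the identity, so that iterated cokernels
become zero. -/
lemma IsClusterTilting.exists_mono_leftApproximation (hM : IsClusterTilting d M)
    (hI : ∀ Y : ModuleCat.{u} R, Module.Finite R Y →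
      ∃ (I : ModuleCat.{u} R) (f : Y ⟶ I), Injective I ∧ Mono f ∧ Module.Finite R I)
    (Y : ModuleCat.{u} R) (hY : Module.Finite R Y) :
    ∃ (X : ModuleCat.{u} R) (f : Y ⟶ X), IsLeftApproximation M f ∧ Mono f ∧ (M Y → IsIso f) := by
  by_cases hMY : M Y
  · exact ⟨Y, 𝟙 Y, ⟨hMY, fun X' g _ => ⟨g, Category.id_comp g⟩⟩, inferInstance,
      fun _ => inferInstance⟩
  obtain ⟨X, f, hf⟩ := hM.functoriallyFinite.covariantly Y hY
  obtain ⟨I, j, hInj, hj, hfin⟩ := hI Y hY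
  have hMI : M I := (hM.mem_iff_right I).2 ⟨hfin, fun N _ i h1 _ => by
    obtain ⟨i, rfl⟩ := Nat.exists_eq_add_of_le' h1
    exact subsingleton_of_forall_eq 0 Abelian.Ext.eq_zero_of_injective⟩
  obtain ⟨h, rfl⟩ := hf.2 I j hMI
  exact ⟨X, f, hf, mono_of_mono f h, fun h => absurd h hMY⟩

lemma isZero_of_isIso_ι (S : SplicedSequence R) {n : ℕ} (h : IsIso (S.ι n)) :
    IsZero (S.Z (n + 1)) := by
  have := S.epi_π n
  have h0 : S.π n = 0 := by rw [← cancel_epi (S.ι n), S.zero, comp_zero]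
  exact IsZero.of_epi_eq_zero _ h0

/-- Every finitely generated module has an `M`-coresolution with `d` terms. -/
lemma IsClusterTilting.exists_coresolution (hM : IsClusterTilting d M) (hd : 1 ≤ d)
    (hI : ∀ Y : ModuleCat.{u} R, Module.Finite R Y →
      ∃ (I : ModuleCat.{u} R) (f : Y ⟶ I), Injective I ∧ Mono f ∧ Module.Finite R I)
    (Y : ModuleCat.{u} R) (hY : Module.Finite R Y) :
    ∃ S : SplicedSequence R, S.Z 0 = Y ∧ (∀ n, M (S.X n)) ∧ ∀ n, d ≤ n → IsZero (S.X n) := by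
  choose V ι hι hmono hiso using hM.exists_mono_leftApproximation hI
  let C : ℕ → {Y : ModuleCat.{u} R // Module.Finite R Y} := fun n => Nat.rec ⟨Y, hY⟩
    (fun _ Z => ⟨cokernel (ι Z.1 Z.2), finite_of_epi (cokernel.π _) (hM.finite (hι Z.1 Z.2).1)⟩) n
  let S : SplicedSequence R :=
    { Z := fun n => (C n).1
      X := fun n => V (C n).1 (C n).2
      ι := fun n => ι (C n).1 (C n).2
      π := fun n => cokernel.π (ι (C n).1 (C n).2)
      zero := fun n => cokernel.condition _
      shortExact := fun n => by
        have := hmono (C n).1 (C n).2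
        exact ShortComplex.ShortExact.mk'
          (ShortComplex.exact_of_g_is_cokernel _ (cokernelIsCokernel _)) this
          (inferInstanceAs (Epi (cokernel.π _))) }
  have hX : ∀ n, M (S.X n) := fun n => (hι (C n).1 (C n).2).1
  -- The approximation property kills `Ext¹` of each cokernel into `M`, and each further cokernel
  -- shifts this up one degree. Hence the cosyzygy of index `d - 1` lies in `M`.
  have hext : ∀ N, M N → ∀ n i, 1 ≤ i → i ≤ n → i ≤ d - 1 →
      Subsingleton (Abelian.Ext.{u} (S.Z n) N i) := by
    intro N hN n
    induction n with
    | zero => intro i h1 h2; omega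
    | succ n ih =>
      intro i h1 h2 h3
      obtain ⟨i, rfl⟩ := Nat.exists_eq_add_of_le' h1
      rcases Nat.eq_zero_or_pos i with rfl | hi
      · exact ext_one_subsingleton_of_extend (S.shortExact n) N
          (fun g => (hι (C n).1 (C n).2).2 N g hN) (hM.ext_subsingleton (hX n) hN 1 le_rfl h3)
      · exact ext_subsingleton_contra_X₃ (S.shortExact n) N i (ih i hi (by omega) (by omega))
          (hM.ext_subsingleton (hX n) hN _ h1 h3)
  have hZ : M (S.Z (d - 1)) := (hM.mem_iff_left _).2 ⟨(C (d - 1)).2,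
    fun N hN i h1 h2 => hext N hN _ i h1 h2 h2⟩
  have hiso' : ∀ n, M (S.Z n) → IsIso (S.ι n) := fun n => hiso (C n).1 (C n).2
  have hzero : ∀ n, d ≤ n → IsZero (S.Z n) := by
    intro n hn
    induction n, hn using Nat.le_induction with
    | base =>
      have := isZero_of_isIso_ι S (hiso' _ hZ)
      rwa [Nat.sub_add_cancel hd] at this
    | succ n _ ih => exact isZero_of_isIso_ι S (hiso' n (hM.subcategory.zero _ ih))
  refine ⟨S, rfl, hX, fun n hn => ?_⟩
  have := hiso' n (hM.subcategory.zero _ (hzero n hn))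
  exact (hzero n hn).of_iso (asIso (S.ι n)).symm

end Coresolution

/-! ### Torsion sequences and the characterization -/

section Torsion

variable {R : Type u} [Ring R] {d : ℕ} {M T F : ObjectProperty (ModuleCat.{u} R)}

lemma IsSubcategory.inf (hT : IsSubcategory T) (hM : IsSubcategory M) : IsSubcategory (T ⊓ M) where
  finite X h := hT.finite X h.1
  iso e h := ⟨hT.iso e h.1, hM.iso e h.2⟩
  zero X h := ⟨hT.zero X h, hM.zero X h⟩
  sum X Y hX hY := ⟨hT.sum X Y hX.1 hY.1, hM.sum X Y hX.2 hY.2⟩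
  summand X Y h := ⟨hT.summand X Y h.1, hM.summand X Y h.2⟩

lemma IsTorsionPair.isTorsionSequence_id (hF : IsTorsionPair T F) {U : ModuleCat.{u} R}
    (hU : T U) : IsTorsionSequence T F (𝟙 U) (0 : U ⟶ ModuleCat.of R PUnit) := by
  have h0 : IsZero (ModuleCat.of R PUnit.{u + 1}) := ModuleCat.isZero_of_subsingleton _
  refine ⟨hU, hF.subcategory_right.zero _ h0, comp_zero, ShortComplex.ShortExact.mk' ?_ ?_ ?_⟩
  · rw [ShortComplex.exact_iff_epi _ rfl]
    exact inferInstanceAs (Epi (𝟙 U))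
  · exact inferInstanceAs (Mono (𝟙 U))
  · exact ⟨fun _ _ _ => h0.eq_of_src _ _⟩

/-- Such a `U` is its own torsion part, so the Ext condition on the `tX` applies to all of `T ⊓ M`.
-/
lemma mem_torsionPart (hT : IsTorsionClass T) {U : ModuleCat.{u} R} (hU : (T ⊓ M) U) :
    torsionPart T M U := by
  obtain ⟨F, hF⟩ := hT
  exact ⟨U, _, 𝟙 U, 0, hU.2, F, hF, hF.isTorsionSequence_id hU.1⟩

lemma IsCanonicalSequence.of_iso {tX X fX X' : ModuleCat.{u} R} {i : tX ⟶ X} {p : X ⟶ fX}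
    (h : IsCanonicalSequence T i p) (e : X' ≅ X) :
    IsCanonicalSequence T (i ≫ e.inv) (e.hom ≫ p) := by
  obtain ⟨F, hF, h1, h2, w, hS⟩ := h
  refine ⟨F, hF, h1, h2, by simpa using w, ShortComplex.shortExact_of_iso
    (S₁ := ShortComplex.mk i p w) (ShortComplex.isoMk (Iso.refl _) e.symm (Iso.refl _) ?_ ?_) hS⟩ <;> simp

lemma IsCanonicalSequence.mem {tX X fX : ModuleCat.{u} R} {i : tX ⟶ X} {p : X ⟶ fX}
    (h : IsCanonicalSequence T i p) : T tX := by
  obtain ⟨F, hF, h1, -⟩ := h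
  exact h1

lemma IsCanonicalSequence.hom_eq_zero {tX X fX U : ModuleCat.{u} R} {i : tX ⟶ X} {p : X ⟶ fX}
    (h : IsCanonicalSequence T i p) (hU : T U) (g : U ⟶ fX) : g = 0 := by
  obtain ⟨F, hF, h1, h2, -⟩ := h
  exact hF.hom_eq_zero _ _ g hU h2

lemma ext_subsingleton_of_iso {U Y Z : ModuleCat.{u} R} (e : Y ≅ Z) (n : ℕ)
    (h : Subsingleton (Abelian.Ext.{u} U Y n)) : Subsingleton (Abelian.Ext.{u} U Z n) := by
  refine subsingleton_of_forall_eq 0 fun x => ?_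
  have hx : x.comp (Abelian.Ext.mk₀ (e.inv ≫ e.hom)) (add_zero n) = x := by simp
  rw [← hx, ← Abelian.Ext.mk₀_comp_mk₀, ← Abelian.Ext.comp_assoc_of_third_deg_zero,
    Subsingleton.elim (x.comp (Abelian.Ext.mk₀ e.inv) _) 0, Abelian.Ext.zero_comp]

/-- The two subobjects factor through each other: `Hom(U_X, fX) = 0` in one direction, and `Hom(tX,
V₁) ⟶ Hom(tX, V₂)` is injective in the other, which is where `tX` in `M` enters. -/
lemma IsDTorsionSequence.exists_iso {K : CochainComplex (ModuleCat.{u} R) ℕ}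
    (hK : IsDTorsionSequence d M (T ⊓ M) K) {Y Z : ModuleCat.{u} R} {i : Y ⟶ K.X 1}
    {p : K.X 1 ⟶ Z} (h : IsCanonicalSequence T i p) (hY : M Y) :
    ∃ e : Y ≅ K.X 0, e.hom ≫ K.d 0 1 = i := by
  have hm : Mono (K.d 0 1) := by
    have := hK.dExact.exact 0
    rw [HomologicalComplex.exactAt_iff' _ 0 0 1 (by simp) (by simp)] at this
    exact this.mono_g (K.shape 0 0 (by simp))
  have hT := h.mem
  have h0 := h.hom_eq_zero hK.mem.1 (K.d 0 1 ≫ p)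
  obtain ⟨F, hF, -, -, w, hS⟩ := h
  have hi : Mono i := hS.mono_f
  have h12 : (ShortComplex.mk (K.d 0 1) (K.d 1 2) (K.d_comp_d _ _ _)).Exact :=
    (K.exactAt_iff' 0 1 2 (by simp) (by simp)).1 (hK.dExact.exact 1)
  have h1 : i ≫ K.d 1 2 = 0 := hK.hom_exact_first Y ⟨hT, hY⟩ _ (by simp)
  have ha : hS.exact.lift (K.d 0 1) h0 ≫ i = K.d 0 1 := hS.exact.lift_f _ _
  have hb : h12.lift i h1 ≫ K.d 0 1 = i := h12.lift_f _ _
  exact ⟨⟨h12.lift i h1, hS.exact.lift (K.d 0 1) h0, by rw [← cancel_mono i]; simp [ha, hb],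
    by rw [← cancel_mono (K.d 0 1)]; simp [ha, hb]⟩, hb⟩

/-- Both are cokernels of the same subobject of `X¹`. -/
lemma SplicedSequence.nonempty_iso_Z_two (S : SplicedSequence R) {Y Z : ModuleCat.{u} R}
    {i : Y ⟶ S.X 1} {p : S.X 1 ⟶ Z} (w : i ≫ p = 0) (hS : (ShortComplex.mk i p w).ShortExact)
    (e : Y ≅ S.X 0) (he : e.hom ≫ S.π 0 ≫ S.ι 1 = i) : Nonempty (S.Z 2 ≅ Z) := by
  have hp : Epi p := hS.epi_g
  have hπ := S.epi_π
  have h1 : S.ι 1 ≫ p = 0 := by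
    rw [← cancel_epi (S.π 0), ← cancel_epi e.hom, comp_zero, comp_zero, ← w, ← he]
    simp
  have h2 : i ≫ S.π 1 = 0 := by
    rw [← he, Category.assoc, Category.assoc, S.zero, comp_zero, comp_zero]
  have ha : S.π 1 ≫ (S.shortExact 1).exact.desc p h1 = p := (S.shortExact 1).exact.g_desc _ _
  have hb : p ≫ hS.exact.desc (S.π 1) h2 = S.π 1 := hS.exact.g_desc _ _
  exact ⟨⟨(S.shortExact 1).exact.desc p h1, hS.exact.desc (S.π 1) h2,
    by rw [← cancel_epi (S.π 1), reassoc_of% ha, hb]; exact (Category.comp_id _).symm,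
    by rw [← cancel_epi p, reassoc_of% hb, ha, Category.comp_id]⟩⟩

lemma IsDTorsionSequence.ext_Z_two {K : CochainComplex (ModuleCat.{u} R) ℕ}
    (hM : IsClusterTilting d M) (hd : 2 ≤ d) (hK : IsDTorsionSequence d M (T ⊓ M) K)
    {U : ModuleCat.{u} R} (hU : (T ⊓ M) U) :
    Subsingleton (Abelian.Ext.{u} U ((SplicedSequence.ofExact K hK.dExact.exact).Z 2) (d - 1)) := by
  obtain ⟨n, rfl⟩ := Nat.exists_eq_add_of_le' hd
  let S := SplicedSequence.ofExact K hK.dExact.exact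
  have hX : ∀ j i, 1 ≤ i → i ≤ n + 1 → Subsingleton (Abelian.Ext.{u} U (S.X j) i) :=
    fun j i => hM.ext_subsingleton hU.2 (hK.dExact.mem j) i
  refine S.ext_Z_of_ext_one U (n + 1) hX n 2 le_rfl ?_
  rw [show 2 + n = n + 2 by omega]
  refine ext_one_subsingleton_of_lift (S.shortExact (n + 2)) U (fun g => ?_)
    (hX _ 1 le_rfl (by omega))
  have := S.mono_ι (n + 3)
  have hd := SplicedSequence.ofExact_π_ι K hK.dExact.exact
  -- Here `n + 2 = d`: this is surjectivity onto `Hom(U, V_d)`.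
  obtain ⟨h, hh⟩ := hK.hom_exact U hU (n + 2) (by omega) le_rfl (g ≫ S.ι (n + 3)) (by
    rw [← hd (n + 3)]
    exact (Category.assoc _ _ _).trans ((congrArg (g ≫ ·) (S.ι_comp (n + 3))).trans comp_zero))
  rw [← hd (n + 2)] at hh
  exact ⟨h, (cancel_mono (S.ι (n + 3))).1 ((Category.assoc _ _ _).trans hh)⟩

lemma IsClusterTilting.exists_isDTorsionSequence (hM : IsClusterTilting d M) (hd : 1 ≤ d)
    (hI : ∀ Y : ModuleCat.{u} R, Module.Finite R Y →
      ∃ (I : ModuleCat.{u} R) (f : Y ⟶ I), Injective I ∧ Mono f ∧ Module.Finite R I)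
    {tX X fX : ModuleCat.{u} R} {i : tX ⟶ X} {p : X ⟶ fX} (h : IsCanonicalSequence T i p)
    (htX : M tX) (hX : M X)
    (hext : ∀ U, (T ⊓ M) U → Subsingleton (Abelian.Ext.{u} U fX (d - 1))) :
    ∃ K : CochainComplex (ModuleCat.{u} R) ℕ,
      IsDTorsionSequence d M (T ⊓ M) K ∧ Nonempty (K.X 1 ≅ X) := by
  have hT := h.mem
  have hhom : ∀ U, T U → ∀ g : U ⟶ fX, g = 0 := fun U hU => h.hom_eq_zero hU
  obtain ⟨F, hF, -, -, w, hS⟩ := h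
  have hp : Epi p := hS.epi_g
  obtain ⟨S, rfl, hSM, hS0⟩ := hM.exists_coresolution hd hI fX (finite_of_epi p (hM.finite hX))
  have h0 : IsZero (ModuleCat.of R PUnit.{u + 1}) := ModuleCat.isZero_of_subsingleton _
  let S₁ := S.cons i p w hS
  -- The leading zero puts `tX` in degree `0`, `X` in degree `1` and the coresolution from degree
  -- `2` on.
  let S₀ := S₁.cons (0 : ModuleCat.of R PUnit.{u + 1} ⟶ tX) (𝟙 tX) zero_comp
    (ShortComplex.ShortExact.mk' ((ShortComplex.exact_iff_mono _ rfl).2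
      (inferInstanceAs (Mono (𝟙 tX)))) ⟨fun _ _ _ => h0.eq_of_tgt _ _⟩
      (inferInstanceAs (Epi (𝟙 tX))))
  have hdiff : ∀ n, S₀.complex.d (n + 2) (n + 3) = S.π n ≫ S.ι (n + 1) := fun n =>
    S₀.complex_d (n + 2)
  have hfac : ∀ n (U : ModuleCat.{u} R) (g : U ⟶ S.X n), g ≫ S₀.complex.d (n + 2) (n + 3) = 0 →
      ∃ h : U ⟶ S.Z n, h ≫ S.ι n = g := by
    intro n U g hg
    have := S.mono_ι (n + 1)
    refine S.exists_factor g ?_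
    rw [hdiff] at hg
    rw [← cancel_mono (S.ι (n + 1)), zero_comp, Category.assoc]
    exact hg
  refine ⟨S₀.complex, ⟨⟨?_, ?_, S₀.complex_exactAt h0⟩, ⟨hT, htX⟩, ?_, ?_⟩, ⟨Iso.refl _⟩⟩
  · rintro (_ | _ | n)
    exacts [htX, hX, hSM n]
  · rintro (_ | _ | n) hn
    · omega
    · omega
    · exact hS0 n (by omega)
  · intro N hN g hg
    obtain ⟨h, rfl⟩ := hfac 0 N g hg
    rw [hhom N hN.1 h]
    exact zero_comp
  · intro N hN j h2 hjd g hg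
    obtain ⟨n, rfl⟩ := Nat.exists_eq_add_of_le' h2
    obtain ⟨h, rfl⟩ := hfac (n + 1) N g hg
    have hZ : ∀ i, 1 ≤ i → i ≤ d - 1 → Subsingleton (Abelian.Ext.{u} N (S.Z 0) i) := by
      intro i h1 h2
      -- Below degree `d - 1`, `tX` and `X` in `M` suffice; only the top degree needs the Ext
      -- condition.
      rcases Nat.lt_or_ge i (d - 1) with h3 | h3
      · exact ext_subsingleton_X₃ hS N i (hM.ext_subsingleton hN.2 hX i h1 h2)
          (hM.ext_subsingleton hN.2 htX (i + 1) (by omega) (by omega))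
      · rw [le_antisymm h2 h3]
        exact hext N hN
    obtain ⟨q, rfl⟩ := exists_lift_of_ext_one (S.shortExact n) N
      (S.ext_Z_of_ext_zero N (d - 1) (fun j i => hM.ext_subsingleton hN.2 (hSM j) i) hZ n 1 le_rfl
        (by omega)) h
    refine ⟨q, ?_⟩
    rw [hdiff]
    exact (Category.assoc _ _ _).symm

theorem inducesDTorsionClass_iff (hd : 1 ≤ d) (hM : IsClusterTilting d M)
    (hI : ∀ Y : ModuleCat.{u} R, Module.Finite R Y →
      ∃ (I : ModuleCat.{u} R) (f : Y ⟶ I), Injective I ∧ Mono f ∧ Module.Finite R I)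
    (hT : IsTorsionClass T) :
    InducesDTorsionClass d M T ↔
      (∀ Y Z, torsionPart T M Y → torsionFreePart T M Z →
        Subsingleton (Abelian.Ext.{u} Y Z (d - 1))) ∧ torsionPart T M ≤ M := by
  constructor
  · intro h
    have h2 : torsionPart T M ≤ M := by
      rintro Y ⟨X, Z, i, p, hX, hip⟩
      obtain ⟨K, hK, ⟨e⟩⟩ := h.isDTorsionClass.exists_sequence X hX
      obtain ⟨e', -⟩ := h.subobject_eq K hK _ _ _ _ (hip.of_iso e)
      exact hM.subcategory.iso e'.symm hK.mem.2
    refine ⟨fun U Z hU hZ => ?_, h2⟩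
    obtain ⟨Y, X, i, p, hX, hip⟩ := hZ
    have hUT : T U := by
      obtain ⟨_, _, _, _, _, hU⟩ := hU
      exact hU.mem
    rcases hd.eq_or_lt with rfl | hd
    · refine subsingleton_of_forall_eq 0 fun x => Abelian.Ext.addEquiv₀.injective ?_
      rw [map_zero]
      exact hip.hom_eq_zero hUT _
    · obtain ⟨K, hK, ⟨e⟩⟩ := h.isDTorsionClass.exists_sequence X hX
      have hc := hip.of_iso e
      obtain ⟨e', he'⟩ := h.subobject_eq K hK _ _ _ _ hc
      obtain ⟨F, hF, -, -, w, hS⟩ := hc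
      obtain ⟨e''⟩ :=
        (SplicedSequence.ofExact K hK.dExact.exact).nonempty_iso_Z_two w hS e'
          (by rw [SplicedSequence.ofExact_π_ι]; exact he')
      exact ext_subsingleton_of_iso e'' _ (hK.ext_Z_two hM hd ⟨hUT, h2 U hU⟩)
  · rintro ⟨h1, h2⟩
    refine ⟨⟨?_, fun X hX => hX.2, fun X hX => ?_⟩, fun K hK Y Z i p hip =>
      hK.exists_iso hip (h2 Y ⟨_, Z, i, p, hK.dExact.mem 1, hip⟩)⟩
    · obtain ⟨F, hF⟩ := hT
      exact hF.subcategory_left.inf hM.subcategory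
    · obtain ⟨F, hF⟩ := id hT
      obtain ⟨tX, fX, i, p, hip⟩ := hF.exists_sequence X (hM.finite hX)
      have hc : IsCanonicalSequence T i p := ⟨F, hF, hip⟩
      exact hM.exists_isDTorsionSequence hd hI hc (h2 _ ⟨X, fX, i, p, hX, hc⟩) hX
        fun U hU => h1 U fX (mem_torsionPart hT hU) ⟨tX, X, i, p, hX, hc⟩

end Torsion

end HigherTorsion
theorem mainTheorem6 (k : Type w) [Field k] (A : Type u) [Ring A] [Algebra k A]
    [Module.Finite k A] (d : ℕ) (hd : 1 ≤ d)
    (M : ObjectProperty (ModuleCat.{u} Aᵐᵒᵖ)) (hM : HigherTorsion.IsClusterTilting d M)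
    (T : ObjectProperty (ModuleCat.{u} Aᵐᵒᵖ)) (hT : HigherTorsion.IsTorsionClass T) :
    HigherTorsion.InducesDTorsionClass d M T ↔
      (∀ Y Z, HigherTorsion.torsionPart T M Y → HigherTorsion.torsionFreePart T M Z →
        Subsingleton (Abelian.Ext.{u} Y Z (d - 1))) ∧
      HigherTorsion.torsionPart T M ≤ M :=
  have : Module.Finite k Aᵐᵒᵖ := Module.Finite.equiv (MulOpposite.opLinearEquiv k)
  HigherTorsion.inducesDTorsionClass_iff hd hM
    (HigherTorsion.exists_mono_injective_finite k) hT
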